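/- Let $E$ be a real topological vector space whose topology is separable and completely metrizable. Assume that the continuous linear functionals separate the points of $E$ and that $E$ is strongly root compact: for every compact $C\subset E$ there is a compact $C_0\subset E$ such that for every $n\ge 1$, every finite sequence $x_1,\dots,x_n\in E$ with $x_n=0$ and $(C+x_i+C+x_j)\cap(C+x_{i+j})\neq\emptyset$ for all $i,j\ge1$ with $i+j\le n$ is contained in $C_0$. Let $\mathcal P(E)$ be the set of Borel probability measures on $E$ with the weak topology, write products for convolutions, let $\delta_x$ be the point mass at $x$, and let $T(\mu)$ denote the image of $\mu$ under $T$. Let $\mathcal L_+$ be the set of all homomorphisms $t\mapsto T_t$ from the multiplicative group $(0,\infty)$ to the group of invertible continuous linear operators on $E$ that are continuous in the strong operator topology and satisfy $T_t(x)\to 0$ as $t\to0$ for all $x\in E$. A triangular system $\{\lambda_{n,j}: n\ge 1,\ 1\le j\le k_n\}$ in $\mathcal P(E)$ is infinitesimal if $\sup_{j}\lambda_{n,j}(E\setminus U)\to0$ as $n\to\infty$ for every open neighbourhood $U$ of $0$. Let $(T_t)\in\mathcal L_+$. - $\mu\in\mathcal P(E)$ is *operator selfdecomposable* with respect to $(T_t)$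 if there are sequences $(\mu_n)$ in $\mathcal P(E)$, $(x_n)$ in $E$ and $b_n>0$ such that $\{T_{1/b_n}(\mu_i): 1\le i\le n\}$ is infinitesimal and $T_{1/b_n}(\mu_1\cdots\mu_n)\,\delta_{x_n}\to\mu$. - For $0<b<1$, $\tilde L_0(b,(T_t))$ is the set of all $\mu\in\mathcal P(E)$ for which there are sequences $(\mu_n)$ in $\mathcal P(E)$, $(x_n)$ in $E$, $a_n>0$ and a strictly increasing sequence $(k_n)$ of positive integers with $a_n/a_{n+1}\to b$ and $T_{1/a_n}(\mu_1\cdots\mu_{k_n})\,\delta_{x_n}\to\mu$. The class $L_0(b,(T_t))$ is defined in the same way, with the additional requirement that $\{T_{1/a_n}(\mu_i):1\le i\le k_n\}$ is infinitesimal. - $L_0([0,1],(T_t))=\bigcap_{0<b<1}L_0(b,(T_t))$ and $\tilde L_0([0,1],(T_t))=\bigcap_{0<b<1}\tilde L_0(b,(T_t))$. **Theorem.** Let $(T_t)\in\mathcal L_+$ and $\mu\in\mathcal P(E)$. The following are equivalent: 1. $\mu$ is operator selfdecomposable with respect to $(T_t)$; 2. $\mu\in L_0([0,1],(T_t))$;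 3. $\mu\in\tilde L_0([0,1],(T_t))$; 4. $\mu\in L_0(b,(T_t))$ for every $0<b<1$. -/

import Mathlib

open Filter Topology MeasureTheory Set
open scoped Pointwise

namespace OpSelfDec

/-- The multiplicative group of positive real numbers. -/
abbrev PosReal : Type := {t : ℝ // 0 < t}

/-- An additive topological group is strongly root compact if for every compact `C` there is a
compact `C₀` containing every finite sequence `x 1, …, x n` with `x n = 0` such that
`C + x i + C + x j` meets `C + x (i + j)` whenever `i, j ≥ 1` and `i + j ≤ n`. -/
def StronglyRootCompact (E : Type*) [TopologicalSpace E] [AddCommGroup E] : Prop :=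
  ∀ C : Set E, IsCompact C → ∃ C₀ : Set E, IsCompact C₀ ∧
    ∀ n : ℕ, 1 ≤ n → ∀ x : ℕ → E, x n = 0 →
      (∀ i j : ℕ, 1 ≤ i → 1 ≤ j → i + j ≤ n →
        ((C + {x i} + C + {x j}) ∩ (C + {x (i + j)})).Nonempty) →
      ∀ i : ℕ, 1 ≤ i → i ≤ n → x i ∈ C₀

section

variable {E : Type*} [AddCommGroup E] [Module ℝ E] [TopologicalSpace E]

/-- The family `(T t)`, `t > 0`, is in `𝓛₊`: it is a homomorphism from the multiplicative group
`(0, ∞)` to the invertible continuous linear operators, continuous for the strong operator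
topology, with `T t x → 0` as `t → 0` for each `x`. -/
structure InLPlus (T : PosReal →* (E ≃L[ℝ] E)) : Prop where
  continuous_apply : ∀ x : E, Continuous fun t : PosReal => T t x
  tendsto_zero : ∀ x : E,
    Tendsto (fun t : PosReal => T t x) (comap (fun t : PosReal => (t : ℝ)) (𝓝 0)) (𝓝 0)

variable [IsTopologicalAddGroup E] [PolishSpace E] [MeasurableSpace E] [BorelSpace E]

/-- The image `S(μ)`. -/
noncomputable def opMap (S : E ≃L[ℝ] E) (μ : ProbabilityMeasure E) : ProbabilityMeasure E :=
  μ.map S.continuous.measurable.aemeasurable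

/-- The convolution of two probability measures. -/
noncomputable def conv (μ ν : ProbabilityMeasure E) : ProbabilityMeasure E :=
  ⟨(μ : Measure E).conv (ν : Measure E), inferInstance⟩

/-- The point mass at `x`. -/
noncomputable def pointMass (x : E) : ProbabilityMeasure E :=
  ⟨Measure.dirac x, inferInstance⟩

/-- The convolution `μ 0 * μ 1 * ⋯ * μ (n - 1)` of the first `n` terms of a sequence
(the point mass at `0` if `n = 0`). -/
noncomputable def convProd (μ : ℕ → ProbabilityMeasure E) : ℕ → ProbabilityMeasure E
  | 0 => pointMass 0
  | n + 1 => conv (convProd μ n) (μ n)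

/-- The triangular system `lam n j`, `j < k n`, is infinitesimal:
`sup_j lam n j (E \ U) → 0` as `n → ∞` for each open neighbourhood `U` of `0`. -/
def Infinitesimal (k : ℕ → ℕ) (lam : ℕ → ℕ → ProbabilityMeasure E) : Prop :=
  ∀ U : Set E, IsOpen U → (0 : E) ∈ U →
    Tendsto (fun n => ⨆ j ∈ Finset.range (k n), (lam n j : Measure E) Uᶜ) atTop (𝓝 0)

/-- The class `K̃(H, b, (T t))`. -/
def KTilde (H : Set (ProbabilityMeasure E)) (b : ℝ) (T : PosReal →* (E ≃L[ℝ] E)) :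
    Set (ProbabilityMeasure E) :=
  {μ | ∃ (m : ℕ → ProbabilityMeasure E) (a : ℕ → PosReal) (k : ℕ → ℕ) (x : ℕ → E),
    (∀ i, m i ∈ H) ∧ StrictMono k ∧
    Tendsto (fun n => (a n : ℝ) / (a (n + 1) : ℝ)) atTop (𝓝 b) ∧
    Tendsto (fun n => conv (opMap (T (a n)⁻¹) (convProd m (k n))) (pointMass (x n)))
      atTop (𝓝 μ)}

/-- The class `K(H, b, (T t))`: as `K̃(H, b, (T t))`, with the additional requirement that the
triangular system `T_{1 / a n} (m i)`, `i < k n`, is infinitesimal. -/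
def K (H : Set (ProbabilityMeasure E)) (b : ℝ) (T : PosReal →* (E ≃L[ℝ] E)) :
    Set (ProbabilityMeasure E) :=
  {μ | ∃ (m : ℕ → ProbabilityMeasure E) (a : ℕ → PosReal) (k : ℕ → ℕ) (x : ℕ → E),
    (∀ i, m i ∈ H) ∧ StrictMono k ∧
    Tendsto (fun n => (a n : ℝ) / (a (n + 1) : ℝ)) atTop (𝓝 b) ∧
    Tendsto (fun n => conv (opMap (T (a n)⁻¹) (convProd m (k n))) (pointMass (x n)))
      atTop (𝓝 μ) ∧
    Infinitesimal k (fun n i => opMap (T (a n)⁻¹) (m i))}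

/-- The class `K(H, [0,1], (T t))`, the intersection of the classes `K(H, b, (T t))` over
`b ∈ [0,1] \ {0,1}`. -/
def KUnit (H : Set (ProbabilityMeasure E)) (T : PosReal →* (E ≃L[ℝ] E)) :
    Set (ProbabilityMeasure E) :=
  ⋂ b ∈ Icc (0 : ℝ) 1 \ {0, 1}, K H b T

/-- The class `K̃(H, [0,1], (T t))`. -/
def KTildeUnit (H : Set (ProbabilityMeasure E)) (T : PosReal →* (E ≃L[ℝ] E)) :
    Set (ProbabilityMeasure E) :=
  ⋂ b ∈ Icc (0 : ℝ) 1 \ {0, 1}, KTilde H b T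

/-- The class `L₀(b, (T t))`. -/
def L0 (b : ℝ) (T : PosReal →* (E ≃L[ℝ] E)) : Set (ProbabilityMeasure E) :=
  K Set.univ b T

/-- The class `L₀([0,1], (T t))`. -/
def L0Unit (T : PosReal →* (E ≃L[ℝ] E)) : Set (ProbabilityMeasure E) :=
  KUnit Set.univ T

/-- The class `L̃₀([0,1], (T t))`. -/
def L0TildeUnit (T : PosReal →* (E ≃L[ℝ] E)) : Set (ProbabilityMeasure E) :=
  KTildeUnit Set.univ T

/-- `μ` is operator selfdecomposable with respect to `(T t)`. -/
def OperatorSelfdecomposable (T : PosReal →* (E ≃L[ℝ] E)) (μ : ProbabilityMeasure E) : Prop :=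
  ∃ (m : ℕ → ProbabilityMeasure E) (x : ℕ → E) (b : ℕ → PosReal),
    Infinitesimal (fun n => n) (fun n i => opMap (T (b n)⁻¹) (m i)) ∧
    Tendsto (fun n => conv (opMap (T (b n)⁻¹) (convProd m n)) (pointMass (x n))) atTop (𝓝 μ)

end

end OpSelfDec

/-! All four conditions are equivalent to decomposability: for every `0 < c < 1` the measure `T c
(μ)` is a convolution factor of `μ`. Necessity rests on compactness of cofactors
(`exists_tendsto_cofactor`). A shorter partial convolution divides a longer one, so when the ratio
of their normalizing constants tends to `c`, passing to the limit gives a factorization of `μ` by `T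
c (μ)` (`exists_conv_act_eq_of_tendsto`). In the classes with a prescribed ratio, consecutive terms
suffice. For operator selfdecomposability one first proves, for nondegenerate `μ`, that `b n → ∞`
and `b n / b (n + 1) → 1`, and then selects indices whose ratio tends to `c`. Conversely, let `ν n`
be a cofactor of `T (n / (n + 1)) (μ)` in `μ`. With `m i = T (i + 1) (ν i)` the partial convolutions
telescope to `T n (μ)`, and normalization by `n + 1` gives convergence to `μ`
(`exists_infinitesimal_tendsto`). The system is infinitesimal because `ν n → δ_0`. A geometrically
growing subsequence of this one construction serves each `b`. -/

namespace OpSelfDec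

set_option linter.unusedSectionVars false

/-! ### Joint continuity of the action on `E`, extended by `0` to nonpositive parameters. -/

section Scale

variable {E : Type*} [AddCommGroup E] [Module ℝ E] [TopologicalSpace E]

open Classical in
/-- The action of `(T t)` extended to all real `t` by `0` for `t ≤ 0`. -/
noncomputable def scale (T : PosReal →* (E ≃L[ℝ] E)) (t : ℝ) (x : E) : E :=
  if h : 0 < t then T ⟨t, h⟩ x else 0

variable {T : PosReal →* (E ≃L[ℝ] E)}

lemma scale_of_pos {t : ℝ} (ht : 0 < t) (x : E) : scale T t x = T ⟨t, ht⟩ x := dif_pos ht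

lemma scale_of_nonpos {t : ℝ} (ht : t ≤ 0) (x : E) : scale T t x = 0 := dif_neg ht.not_gt

lemma scale_add (t : ℝ) (x y : E) : scale T t (x + y) = scale T t x + scale T t y := by
  rcases lt_or_ge 0 t with h | h
  · simp [scale_of_pos h]
  · simp [scale_of_nonpos h]

lemma scale_smul (t c : ℝ) (x : E) : scale T t (c • x) = c • scale T t x := by
  rcases lt_or_ge 0 t with h | h
  · simp [scale_of_pos h]
  · simp [scale_of_nonpos h]

lemma scale_neg (t : ℝ) (x : E) : scale T t (-x) = -scale T t x := by
  simpa using scale_smul (T := T) t (-1) x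

lemma scale_sub (t : ℝ) (x y : E) : scale T t (x - y) = scale T t x - scale T t y := by
  rw [sub_eq_add_neg, scale_add, scale_neg, sub_eq_add_neg]

lemma scale_apply_zero (t : ℝ) : scale T t (0 : E) = 0 := by
  simpa using scale_smul (T := T) t 0 (0 : E)

lemma scale_one (x : E) : scale T 1 x = x := by
  rw [scale_of_pos one_pos]
  have : (⟨1, one_pos⟩ : PosReal) = 1 := rfl
  rw [this, map_one]
  rfl

lemma scale_mul {s t : ℝ} (hs : 0 ≤ s) (ht : 0 ≤ t) (x : E) :
    scale T (s * t) x = scale T s (scale T t x) := by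
  rcases hs.eq_or_lt with rfl | hs
  · simp [scale_of_nonpos]
  rcases ht.eq_or_lt with rfl | ht
  · simp [scale_of_nonpos, scale_apply_zero]
  rw [scale_of_pos hs, scale_of_pos ht, scale_of_pos (mul_pos hs ht)]
  have : (⟨s * t, mul_pos hs ht⟩ : PosReal) = ⟨s, hs⟩ * ⟨t, ht⟩ := rfl
  rw [this, map_mul]
  rfl

lemma continuous_scale_right (t : ℝ) : Continuous (scale T t : E → E) := by
  rcases lt_or_ge 0 t with h | h
  · rw [show (scale T t : E → E) = T ⟨t, h⟩ from funext (scale_of_pos h)]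
    exact (T ⟨t, h⟩).continuous
  · rw [show (scale T t : E → E) = fun _ => 0 from funext (scale_of_nonpos h)]
    exact continuous_const

lemma continuous_scale_left (hT : InLPlus T) (x : E) : Continuous fun t => scale T t x := by
  rw [continuous_iff_continuousAt]
  intro t
  rcases lt_trichotomy t 0 with h | rfl | h
  · refine (continuousAt_const (y := (0 : E))).congr ?_
    filter_upwards [Iio_mem_nhds h] with s hs
    exact (scale_of_nonpos (le_of_lt hs) x).symm
  · rw [ContinuousAt, scale_of_nonpos le_rfl]
    intro U hU
    have h := hT.tendsto_zero x hU
    rw [Filter.mem_map, Filter.mem_comap] at h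
    obtain ⟨V, hV, hVU⟩ := h
    rw [Filter.mem_map]
    filter_upwards [hV] with s hs
    rcases lt_or_ge 0 s with h | h
    · rw [mem_preimage, scale_of_pos h]
      exact hVU (show ((⟨s, h⟩ : PosReal) : ℝ) ∈ V from hs)
    · rw [mem_preimage, scale_of_nonpos h]
      exact mem_of_mem_nhds hU
  · have h1 : ContinuousOn (fun t => scale T t x) (Ioi 0) := by
      rw [continuousOn_iff_continuous_domRestrict]
      refine (hT.continuous_apply x).congr fun s => ?_
      exact (scale_of_pos s.2 x).symm
    exact h1.continuousAt (Ioi_mem_nhds h)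

/-- A Banach–Steinhaus argument: orbits over bounded parameter sets are relatively compact, hence
bounded, and Baire's theorem turns pointwise boundedness into equicontinuity. -/
lemma equicontinuous_scale [IsTopologicalAddGroup E] [ContinuousSMul ℝ E] [BaireSpace E]
    (hT : InLPlus T) (M : ℝ) {U : Set E} (hU : U ∈ 𝓝 (0 : E)) :
    ∃ V ∈ 𝓝 (0 : E), ∀ t ≤ M, ∀ x ∈ V, scale T t x ∈ U := by
  obtain ⟨W, hW, hWU⟩ : ∃ W ∈ 𝓝 (0 : E), ∀ v ∈ W, ∀ w ∈ W, v - w ∈ U := by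
    have h : Tendsto (fun p : E × E => p.1 - p.2) (𝓝 (0 : E) ×ˢ 𝓝 (0 : E)) (𝓝 0) := by
      have h0 := (by fun_prop : Continuous fun p : E × E => p.1 - p.2).tendsto (0, 0)
      rwa [nhds_prod_eq, sub_zero] at h0
    obtain ⟨W, hW, hWW⟩ := Filter.mem_prod_self_iff.1 (h hU)
    exact ⟨W, hW, fun v hv w hw => hWW (mk_mem_prod hv hw)⟩
  obtain ⟨V, hV, hVc, hVW⟩ := exists_mem_nhds_isClosed_subset hW
  let A : ℕ → Set E := fun k => {x | ∀ t ≤ M, ((k : ℝ) + 1)⁻¹ • scale T t x ∈ V}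
  have hA : ∀ k, IsClosed (A k) := fun k => by
    simp only [A, ofPred_forall]
    exact isClosed_iInter fun t => isClosed_iInter fun _ =>
      hVc.preimage ((continuous_scale_right t).const_smul _)
  have hcover : ⋃ k, A k = univ := by
    refine eq_univ_of_forall fun x => ?_
    -- The point `0` accounts for the negative parameters; a compact set is absorbed by `V`.
    have hK : IsCompact ((fun t => scale T t x) '' Icc 0 M ∪ {0}) :=
      (isCompact_Icc.image (continuous_scale_left hT x)).union isCompact_singleton
    have h0 : ∀ᶠ s : ℝ in 𝓝 0, ∀ y ∈ (fun t => scale T t x) '' Icc 0 M ∪ {0}, s • y ∈ V := by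
      refine hK.eventually_forall_of_forall_eventually fun y _ => ?_
      have : ContinuousAt (fun p : ℝ × E => p.1 • p.2) (0, y) := continuous_smul.continuousAt
      exact this.eventually_mem (by simpa using hV)
    have h1 : Tendsto (fun k : ℕ => ((k : ℝ) + 1)⁻¹) atTop (𝓝 0) := by
      simpa using tendsto_one_div_add_atTop_nhds_zero_nat (𝕜 := ℝ)
    obtain ⟨k, hk⟩ := (h1.eventually h0).exists
    refine mem_iUnion.2 ⟨k, fun t ht => hk _ ?_⟩
    rcases le_or_gt 0 t with h | h
    · exact Or.inl ⟨t, ⟨h, ht⟩, rfl⟩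
    · exact Or.inr (scale_of_nonpos h.le x)
  obtain ⟨k, x₀, hx₀⟩ := nonempty_interior_of_iUnion_of_closed hA hcover
  have hc : Continuous fun w : E => x₀ + ((k : ℝ) + 1) • w := by fun_prop
  refine ⟨{w | x₀ + ((k : ℝ) + 1) • w ∈ A k},
    hc.continuousAt.preimage_mem_nhds (by simpa using mem_interior_iff_mem_nhds.1 hx₀),
    fun t ht w hw => ?_⟩
  have hk : ((k : ℝ) + 1) ≠ 0 := by positivity
  have h := hWU _ (hVW (hw t ht)) _ (hVW (interior_subset hx₀ t ht))
  rwa [← smul_sub, ← scale_sub, add_sub_cancel_left, scale_smul, smul_smul, inv_mul_cancel₀ hk,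
    one_smul] at h

lemma continuous_scale [IsTopologicalAddGroup E] [ContinuousSMul ℝ E] [BaireSpace E]
    (hT : InLPlus T) : Continuous fun p : ℝ × E => scale T p.1 p.2 := by
  rw [continuous_iff_continuousAt]
  rintro ⟨t, x⟩
  have h1 : Tendsto (fun p : ℝ × E => scale T p.1 (p.2 - x)) (𝓝 (t, x)) (𝓝 0) := by
    intro U hU
    obtain ⟨V, hV, hVU⟩ := equicontinuous_scale hT (t + 1) hU
    have ha : ∀ᶠ p : ℝ × E in 𝓝 (t, x), p.1 < t + 1 :=
      continuous_fst.continuousAt.eventually_lt continuousAt_const (by simp)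
    have hc : ContinuousAt (fun p : ℝ × E => p.2 - x) (t, x) := by fun_prop
    have hb := hc.eventually_mem (s := V) (by simpa using hV)
    rw [Filter.mem_map]
    filter_upwards [ha, hb] with p hp hp'
    exact hVU _ hp.le _ hp'
  have h2 : Tendsto (fun p : ℝ × E => scale T p.1 x) (𝓝 (t, x)) (𝓝 (scale T t x)) :=
    ((continuous_scale_left hT x).comp continuous_fst).tendsto (t, x)
  have h3 := h1.add h2
  rw [zero_add] at h3
  refine h3.congr fun p => ?_
  rw [← scale_add, sub_add_cancel]

end Scale

/-! ### Convolution, compactness of cofactors, and convergence to the point mass at `0`. -/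

section Convolution

variable {E : Type*} [AddCommGroup E] [TopologicalSpace E]
  [IsTopologicalAddGroup E] [PolishSpace E] [MeasurableSpace E] [BorelSpace E]

lemma coe_conv (μ ν : ProbabilityMeasure E) :
    (conv μ ν : Measure E) = (μ : Measure E).conv (ν : Measure E) := rfl

lemma coe_pointMass (x : E) : (pointMass x : Measure E) = Measure.dirac x := rfl

lemma conv_comm (μ ν : ProbabilityMeasure E) : conv μ ν = conv ν μ :=
  Subtype.ext (Measure.conv_comm _ _)

lemma conv_assoc (μ ν ρ : ProbabilityMeasure E) : conv (conv μ ν) ρ = conv μ (conv ν ρ) :=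
  Subtype.ext (Measure.conv_assoc _ _ _)

instance : Std.Commutative (conv (E := E)) := ⟨conv_comm⟩

instance : Std.Associative (conv (E := E)) := ⟨conv_assoc⟩

lemma conv_pointMass_zero (μ : ProbabilityMeasure E) : conv μ (pointMass 0) = μ :=
  Subtype.ext (Measure.conv_dirac_zero _)

lemma pointMass_zero_conv (μ : ProbabilityMeasure E) : conv (pointMass 0) μ = μ := by
  rw [conv_comm, conv_pointMass_zero]

lemma conv_pointMass (x y : E) : conv (pointMass x) (pointMass y) = pointMass (x + y) :=
  Subtype.ext (Measure.dirac_conv_dirac _ _)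

lemma continuous_conv :
    Continuous fun p : ProbabilityMeasure E × ProbabilityMeasure E => conv p.1 p.2 :=
  (ProbabilityMeasure.continuous_map continuous_add).comp ProbabilityMeasure.continuous_prod

lemma tendsto_conv {ι : Type*} {l : Filter ι} {a b : ι → ProbabilityMeasure E}
    {α β : ProbabilityMeasure E} (ha : Tendsto a l (𝓝 α)) (hb : Tendsto b l (𝓝 β)) :
    Tendsto (fun i => conv (a i) (b i)) l (𝓝 (conv α β)) :=
  (continuous_conv.tendsto (α, β)).comp (ha.prodMk_nhds hb)

/-- A convergent sequence of probability measures is tight. -/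
lemma isTightMeasureSet_range {X : Type*} [TopologicalSpace X] [PolishSpace X]
    [MeasurableSpace X] [BorelSpace X] {a : ℕ → ProbabilityMeasure X} {α : ProbabilityMeasure X}
    (ha : Tendsto a atTop (𝓝 α)) : IsTightMeasureSet (range fun n => (a n : Measure X)) := by
  let _ := TopologicalSpace.upgradeIsCompletelyMetrizable X
  have h : IsCompact (closure (range a)) :=
    ha.isCompact_insert_range.closure_of_subset (subset_insert _ _)
  refine (isTightMeasureSet_of_isCompact_closure h).subset ?_
  rintro _ ⟨n, rfl⟩
  exact ⟨a n, mem_range_self n, rfl⟩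

/-- If `a n → α` and `a n * b n → γ`, then `b n` converges along a subsequence to a cofactor
of `α` in `γ`. -/
lemma exists_tendsto_cofactor {a b : ℕ → ProbabilityMeasure E} {α γ : ProbabilityMeasure E}
    (ha : Tendsto a atTop (𝓝 α)) (hab : Tendsto (fun n => conv (a n) (b n)) atTop (𝓝 γ)) :
    ∃ (φ : ℕ → ℕ) (β : ProbabilityMeasure E), StrictMono φ ∧
      Tendsto (b ∘ φ) atTop (𝓝 β) ∧ conv α β = γ := by
  -- Joint laws of `(X, X + Y)` are tight because both marginals are; subtracting coordinates then
  -- gives tightness of the laws of `Y`.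
  let f : E × E → E × E := fun p => (p.1, p.1 + p.2)
  have hf : Measurable f := (by fun_prop : Continuous f).measurable
  let S : Set (Measure (E × E)) :=
    range fun n => ((a n : Measure E).prod (b n : Measure E)).map f
  have hS : IsTightMeasureSet S := by
    refine IsTightMeasureSet.prodMk ((isTightMeasureSet_range ha).subset ?_)
      ((isTightMeasureSet_range hab).subset ?_)
    · rintro _ ⟨_, ⟨n, rfl⟩, rfl⟩
      refine ⟨n, ?_⟩
      rw [Measure.fst, Measure.map_map measurable_fst hf]
      exact (Measure.fst_prod (μ := (a n : Measure E)) (ν := (b n : Measure E))).symm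
    · rintro _ ⟨_, ⟨n, rfl⟩, rfl⟩
      refine ⟨n, ?_⟩
      rw [Measure.snd, Measure.map_map measurable_snd hf]
      rfl
  have hg : Continuous fun p : E × E => p.2 - p.1 := by fun_prop
  have hb : IsTightMeasureSet {((μ : ProbabilityMeasure E) : Measure E) | μ ∈ range b} := by
    refine (hS.map hg).subset ?_
    rintro _ ⟨_, ⟨n, rfl⟩, rfl⟩
    refine ⟨_, mem_range_self n, ?_⟩
    rw [Measure.map_map hg.measurable hf]
    have : (fun p : E × E => p.2 - p.1) ∘ f = Prod.snd := by
      ext p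
      simp [f]
    rw [this]
    exact Measure.snd_prod (μ := (a n : Measure E)) (ν := (b n : Measure E))
  obtain ⟨β, -, φ, hφ, hβ⟩ := (isCompact_closure_of_isTightMeasureSet hb).tendsto_subseq
    fun n => subset_closure (mem_range_self n)
  refine ⟨φ, β, hφ, hβ, tendsto_nhds_unique (tendsto_conv (ha.comp hφ.tendsto_atTop) hβ) ?_⟩
  exact hab.comp hφ.tendsto_atTop

/-- Where the characteristic function equals `1`, the nonnegative variable `1 - cos (t x)` has mean
zero, so `t x` lies in `2πℤ` almost surely; arbitrarily small `t` leave only `x = 0`. -/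
lemma eq_dirac_zero_of_charFun_eventually_eq_one {ν : Measure ℝ} [IsProbabilityMeasure ν]
    (h : ∀ᶠ t in 𝓝 0, charFun ν t = 1) : ∀ᵐ x ∂ν, x = 0 := by
  obtain ⟨δ, hδ, hδt⟩ := Metric.eventually_nhds_iff.1 h
  have key : ∀ t, charFun ν t = 1 → ∀ᵐ x ∂ν, Real.cos (t * x) = 1 := by
    intro t ht
    have hi : Integrable (fun x : ℝ => Complex.exp (t * x * Complex.I)) ν := by
      refine Integrable.of_bound (by fun_prop) 1 (.of_forall fun x => ?_)
      rw [← Complex.ofReal_mul, Complex.norm_exp_ofReal_mul_I]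
    have hre : ∫ x, Real.cos (t * x) ∂ν = 1 := by
      rw [charFun_apply_real] at ht
      have h2 := congrArg Complex.re ht
      rw [← RCLike.re_eq_complex_re, ← integral_re hi] at h2
      refine (integral_congr_ae (.of_forall fun x => ?_)).trans (h2.trans (by simp))
      simp only [RCLike.re_eq_complex_re]
      rw [← Complex.ofReal_mul, Complex.exp_ofReal_mul_I_re]
    have hic : Integrable (fun x => Real.cos (t * x)) ν := by
      refine Integrable.of_bound (by fun_prop) 1 (.of_forall fun x => ?_)
      exact Real.abs_cos_le_one _
    have h0 : ∫ x, (1 - Real.cos (t * x)) ∂ν = 0 := by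
      rw [integral_sub (integrable_const _) hic, hre]
      simp
    rw [integral_eq_zero_iff_of_nonneg (fun x => sub_nonneg.2 (Real.cos_le_one _))
      ((integrable_const _).sub hic)] at h0
    filter_upwards [h0] with x hx
    exact (sub_eq_zero.1 hx).symm
  have hall : ∀ᵐ x ∂ν, ∀ k : ℕ, Real.cos (δ / 2 / ((k : ℝ) + 1) * x) = 1 := by
    refine ae_all_iff.2 fun k => key _ (hδt ?_)
    rw [Real.dist_0_eq_abs, abs_of_pos (by positivity)]
    exact (div_le_self (by positivity) (by linarith [k.cast_nonneg (α := ℝ)])).trans_lt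
      (by linarith)
  filter_upwards [hall] with x hx
  obtain ⟨k, hk⟩ := exists_nat_gt (δ / 2 * |x|)
  have hlt : |δ / 2 / ((k : ℝ) + 1) * x| < 2 * Real.pi := by
    rw [abs_mul, abs_of_pos (by positivity), div_mul_eq_mul_div, div_lt_iff₀ (by positivity)]
    nlinarith [Real.pi_gt_three, k.cast_nonneg (α := ℝ)]
  have h0 := (Real.cos_eq_one_iff_of_lt_of_lt (neg_lt_of_abs_lt hlt) (lt_of_abs_lt hlt)).1 (hx k)
  exact (mul_eq_zero.1 h0).resolve_left (by positivity)

/-- A cofactor of a probability measure in itself is the point mass at `0`. -/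
lemma eq_pointMass_zero_of_conv_eq_self [Module ℝ E] [SeparatingDual ℝ E] {μ ν : ProbabilityMeasure E}
    (h : conv μ ν = μ) : ν = pointMass 0 := by
  have hf : ∀ f : E →L[ℝ] ℝ, (ν : Measure E) {x | f x ≠ 0} = 0 := by
    intro f
    have hfm : Measurable f := f.continuous.measurable
    have := Measure.isProbabilityMeasure_map (μ := (μ : Measure E)) hfm.aemeasurable
    have := Measure.isProbabilityMeasure_map (μ := (ν : Measure E)) hfm.aemeasurable
    have hm : ((μ : Measure E).map f).conv ((ν : Measure E).map f) = (μ : Measure E).map f := by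
      conv_rhs => rw [← h]
      rw [coe_conv, Measure.map_conv_continuousLinearMap]
    -- The characteristic function can be cancelled only where it is nonzero, which continuity
    -- ensures near `0`.
    have hc : ContinuousAt (charFun ((μ : Measure E).map f)) 0 := continuous_charFun.continuousAt
    have hne : ∀ᶠ t in 𝓝 0, charFun ((μ : Measure E).map f) t ≠ 0 :=
      hc.eventually_ne (by simp)
    have h1 : ∀ᶠ t in 𝓝 0, charFun ((ν : Measure E).map f) t = 1 := by
      filter_upwards [hne] with t ht
      have h2 := charFun_conv (μ := (μ : Measure E).map f) (ν := (ν : Measure E).map f) t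
      rw [hm] at h2
      exact mul_left_cancel₀ ht (by rw [← h2, mul_one])
    exact ae_of_ae_map hfm.aemeasurable (eq_dirac_zero_of_charFun_eventually_eq_one h1)
  have h0 : (ν : Measure E) {x | x ≠ 0} = 0 := by
    -- Locally, a single functional separates the points from `0`; second countability makes the
    -- local statement enough.
    refine measure_null_of_locally_null _ fun x hx => ?_
    obtain ⟨f, hfx⟩ := SeparatingDual.exists_ne_zero (R := ℝ) hx
    refine ⟨{y | f y ≠ 0}, mem_nhdsWithin_of_mem_nhds ?_, hf f⟩
    exact f.continuous.continuousAt.eventually_ne hfx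
  refine Subtype.ext ?_
  have h2 : (fun x : E => x) =ᵐ[(ν : Measure E)] fun _ => 0 := h0
  have h3 := Measure.map_congr (mβ := ‹_›) h2
  rw [Measure.map_id', Measure.map_const] at h3
  simpa using! h3

lemma tendsto_pointMass_zero_iff {ι : Type*} {l : Filter ι} [l.IsCountablyGenerated]
    {a : ι → ProbabilityMeasure E} :
    Tendsto a l (𝓝 (pointMass 0)) ↔
      ∀ U : Set E, IsOpen U → (0 : E) ∈ U →
        Tendsto (fun i => (a i : Measure E) Uᶜ) l (𝓝 0) := by
  rcases l.eq_or_neBot with rfl | hl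
  · simp
  constructor
  · intro h U hU h0
    have h1 := ProbabilityMeasure.limsup_measure_closed_le_of_tendsto h hU.isClosed_compl
    rw [coe_pointMass, Measure.dirac_apply' _ hU.measurableSet.compl,
      indicator_of_notMem (by simpa using h0)] at h1
    exact tendsto_of_le_liminf_of_limsup_le zero_le h1
  · intro h
    refine tendsto_of_forall_isClosed_limsup_le' fun F hF => ?_
    rw [coe_pointMass, Measure.dirac_apply' _ hF.measurableSet]
    by_cases h0 : (0 : E) ∈ F
    · rw [indicator_of_mem h0]
      exact limsup_le_of_le (by isBoundedDefault) (.of_forall fun i => prob_le_one)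
    · rw [indicator_of_notMem h0]
      have := h Fᶜ hF.isOpen_compl h0
      rw [compl_compl] at this
      exact this.limsup_eq.le

lemma exists_convProd_eq_conv (m : ℕ → ProbabilityMeasure E) {n N : ℕ} (h : n ≤ N) :
    ∃ ρ, convProd m N = conv (convProd m n) ρ := by
  induction N, h using Nat.le_induction with
  | base => exact ⟨pointMass 0, (conv_pointMass_zero _).symm⟩
  | succ N _ ih =>
    obtain ⟨ρ, hρ⟩ := ih
    exact ⟨conv ρ (m N), by rw [convProd, hρ, conv_assoc]⟩

lemma Infinitesimal.tendsto {k : ℕ → ℕ} {lam : ℕ → ℕ → ProbabilityMeasure E}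
    (h : Infinitesimal k lam) {i : ℕ → ℕ} (hi : ∀ᶠ n in atTop, i n < k n) :
    Tendsto (fun n => lam n (i n)) atTop (𝓝 (pointMass 0)) := by
  refine tendsto_pointMass_zero_iff.2 fun U hU h0 => ?_
  refine tendsto_of_tendsto_of_tendsto_of_le_of_le' tendsto_const_nhds (h U hU h0)
    (.of_forall fun _ => zero_le) ?_
  filter_upwards [hi] with n hn
  exact le_iSup₂ (f := fun j (_ : j ∈ Finset.range (k n)) => (lam n j : Measure E) Uᶜ) (i n)
    (Finset.mem_range.2 hn)

end Convolution

/-! ### The induced action on probability measures. -/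

section Action

variable {E : Type*} [AddCommGroup E] [Module ℝ E] [TopologicalSpace E]
  [IsTopologicalAddGroup E] [PolishSpace E] [MeasurableSpace E] [BorelSpace E]
  {T : PosReal →* (E ≃L[ℝ] E)}

/-- The image of a probability measure under `scale T t`. -/
noncomputable def act (T : PosReal →* (E ≃L[ℝ] E)) (t : ℝ) (μ : ProbabilityMeasure E) :
    ProbabilityMeasure E :=
  μ.map (continuous_scale_right (T := T) t).measurable.aemeasurable

lemma opMap_eq_act (s : PosReal) (μ : ProbabilityMeasure E) : opMap (T s) μ = act T s μ := by
  refine Subtype.ext (congrArg (fun f => (μ : Measure E).map f) (funext fun x => ?_))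
  exact (scale_of_pos s.2 x).symm

lemma opMap_inv_eq_act (s : PosReal) (μ : ProbabilityMeasure E) :
    opMap (T s⁻¹) μ = act T (s : ℝ)⁻¹ μ :=
  opMap_eq_act s⁻¹ μ

lemma act_zero (μ : ProbabilityMeasure E) : act T 0 μ = pointMass 0 := by
  refine Subtype.ext ?_
  change (μ : Measure E).map (scale T 0) = Measure.dirac 0
  rw [show (scale T 0 : E → E) = fun _ => 0 from funext (scale_of_nonpos le_rfl),
    Measure.map_const, measure_univ, one_smul]

lemma act_one (μ : ProbabilityMeasure E) : act T 1 μ = μ := by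
  refine Subtype.ext ?_
  change (μ : Measure E).map (scale T 1) = μ
  rw [show (scale T 1 : E → E) = id from funext scale_one, Measure.map_id]

lemma act_mul {s t : ℝ} (hs : 0 ≤ s) (ht : 0 ≤ t) (μ : ProbabilityMeasure E) :
    act T (s * t) μ = act T s (act T t μ) := by
  refine Subtype.ext ?_
  change (μ : Measure E).map (scale T (s * t)) = ((μ : Measure E).map (scale T t)).map (scale T s)
  rw [Measure.map_map (continuous_scale_right s).measurable (continuous_scale_right t).measurable]
  exact congrArg (fun f => (μ : Measure E).map f) (funext fun x => scale_mul hs ht x)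

lemma act_pointMass (t : ℝ) (x : E) : act T t (pointMass x) = pointMass (scale T t x) :=
  Subtype.ext (Measure.map_dirac' (continuous_scale_right t).measurable x)

lemma act_pointMass_zero (t : ℝ) : act T t (pointMass (0 : E)) = pointMass 0 := by
  rw [act_pointMass, scale_apply_zero]

lemma act_conv (t : ℝ) (μ ν : ProbabilityMeasure E) :
    act T t (conv μ ν) = conv (act T t μ) (act T t ν) := by
  let L : E →+ E := ⟨⟨scale T t, scale_apply_zero t⟩, scale_add t⟩
  exact Subtype.ext (Measure.map_conv_addMonoidHom (μ := (μ : Measure E)) (ν := (ν : Measure E)) L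
    (continuous_scale_right (T := T) t).measurable)

/-- The image measure is the push-forward of `δ_t ⊗ μ` under the jointly continuous action, so weak
continuity of products and images applies. -/
lemma continuous_act [ContinuousSMul ℝ E] (hT : InLPlus T) :
    Continuous fun p : ℝ × ProbabilityMeasure E => act T p.1 p.2 := by
  have hc := continuous_scale hT
  have h : Continuous fun p : ℝ × ProbabilityMeasure E =>
      ((diracProba p.1).prod p.2).map hc.measurable.aemeasurable :=
    (ProbabilityMeasure.continuous_map hc).comp (ProbabilityMeasure.continuous_prod.comp
      ((continuous_diracProba.comp continuous_fst).prodMk continuous_snd))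
  refine h.congr fun p => Subtype.ext ?_
  change (((Measure.dirac p.1).prod (p.2 : Measure E)).map fun q : ℝ × E => scale T q.1 q.2) =
    (p.2 : Measure E).map (scale T p.1)
  rw [Measure.dirac_prod, Measure.map_map hc.measurable measurable_prodMk_left]
  rfl

lemma tendsto_act [ContinuousSMul ℝ E] (hT : InLPlus T) {ι : Type*} {l : Filter ι} {s : ι → ℝ}
    {c : ℝ} {a : ι → ProbabilityMeasure E} {α : ProbabilityMeasure E} (hs : Tendsto s l (𝓝 c))
    (ha : Tendsto a l (𝓝 α)) : Tendsto (fun i => act T (s i) (a i)) l (𝓝 (act T c α)) :=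
  ((continuous_act hT).tendsto (c, α)).comp (hs.prodMk_nhds ha)

end Action

/-! ### Symmetrization, which removes the uncontrolled shifts. -/

section Symmetrization

variable {E : Type*} [AddCommGroup E] [TopologicalSpace E]
  [IsTopologicalAddGroup E] [PolishSpace E] [MeasurableSpace E] [BorelSpace E]

/-- The image of a probability measure under `x ↦ -x`. -/
noncomputable def reflect (μ : ProbabilityMeasure E) : ProbabilityMeasure E :=
  μ.map (f := fun x => -x) continuous_neg.measurable.aemeasurable

/-- The symmetrization of a probability measure. -/
noncomputable def symmetrize (μ : ProbabilityMeasure E) : ProbabilityMeasure E :=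
  conv μ (reflect μ)

lemma continuous_symmetrize : Continuous (symmetrize : ProbabilityMeasure E → _) :=
  continuous_conv.comp (continuous_id.prodMk (ProbabilityMeasure.continuous_map continuous_neg))

lemma reflect_conv (μ ν : ProbabilityMeasure E) :
    reflect (conv μ ν) = conv (reflect μ) (reflect ν) :=
  Subtype.ext (Measure.map_conv_addMonoidHom (μ := (μ : Measure E)) (ν := (ν : Measure E))
    (negAddMonoidHom : E →+ E) continuous_neg.measurable)

lemma reflect_pointMass (x : E) : reflect (pointMass x) = pointMass (-x) :=
  Subtype.ext (Measure.map_dirac' continuous_neg.measurable x)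

lemma symmetrize_conv (μ ν : ProbabilityMeasure E) :
    symmetrize (conv μ ν) = conv (symmetrize μ) (symmetrize ν) := by
  unfold symmetrize
  rw [reflect_conv]
  ac_rfl

lemma symmetrize_pointMass (x : E) : symmetrize (pointMass x) = pointMass 0 := by
  rw [symmetrize, reflect_pointMass, conv_pointMass, add_neg_cancel]

lemma symmetrize_conv_pointMass (μ : ProbabilityMeasure E) (x : E) :
    symmetrize (conv μ (pointMass x)) = symmetrize μ := by
  rw [symmetrize_conv, symmetrize_pointMass, conv_pointMass_zero]

lemma symmetrize_act [Module ℝ E] {T : PosReal →* (E ≃L[ℝ] E)} (t : ℝ)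
    (μ : ProbabilityMeasure E) : symmetrize (act T t μ) = act T t (symmetrize μ) := by
  have h : reflect (act T t μ) = act T t (reflect μ) := by
    refine Subtype.ext ?_
    change ((μ : Measure E).map (scale T t)).map (fun x => -x) =
      ((μ : Measure E).map (fun x => -x)).map (scale T t)
    have hs := (continuous_scale_right (T := T) t).measurable
    rw [Measure.map_map continuous_neg.measurable hs, Measure.map_map hs continuous_neg.measurable]
    exact congrArg (fun f => (μ : Measure E).map f) (funext fun x => (scale_neg t x).symm)
  rw [symmetrize, h, symmetrize, act_conv]

/-- For independent `X`, `Y` with law `μ`, `X - Y = 0` almost surely; by Fubini, `Y` equals some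
fixed value of `X` almost surely. -/
lemma exists_eq_pointMass_of_symmetrize_eq {μ : ProbabilityMeasure E}
    (h : symmetrize μ = pointMass 0) : ∃ x, μ = pointMass x := by
  have hm : Measurable fun p : E × E => p.1 + p.2 := continuous_add.measurable
  have hn : Measurable fun x : E => -x := continuous_neg.measurable
  have h1 : ((μ : Measure E).prod ((μ : Measure E).map fun x => -x)).map (fun p => p.1 + p.2) =
      Measure.dirac 0 := congrArg Subtype.val h
  have h2 : ∀ᵐ z ∂((μ : Measure E).prod ((μ : Measure E).map fun x => -x)).map
      (fun p => p.1 + p.2), z = 0 := by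
    rw [h1]
    exact (ae_dirac_iff (p := fun z : E => z = 0) (measurableSet_singleton 0)).2 rfl
  have h3 := Measure.ae_ae_of_ae_prod (ae_of_ae_map hm.aemeasurable h2)
  obtain ⟨x, hx⟩ := h3.exists
  have h4 : ∀ᵐ y ∂(μ : Measure E), x + -y = 0 := ae_of_ae_map hn.aemeasurable hx
  have h5 : (fun y : E => y) =ᵐ[(μ : Measure E)] fun _ => x := by
    filter_upwards [h4] with y hy
    exact (add_neg_eq_zero.1 hy).symm
  refine ⟨x, Subtype.ext ?_⟩
  have h6 := Measure.map_congr (mβ := ‹_›) h5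
  rw [Measure.map_id', Measure.map_const] at h6
  simpa using! h6

end Symmetrization

/-! ### From limit theorems to decomposability. -/

section Decomposability

variable {E : Type*} [AddCommGroup E] [Module ℝ E] [TopologicalSpace E]
  [IsTopologicalAddGroup E] [ContinuousSMul ℝ E] [PolishSpace E] [MeasurableSpace E] [BorelSpace E]
  {T : PosReal →* (E ≃L[ℝ] E)}

/-- If normalized shifted partial convolutions converge to `μ` along two sequences of indices
and the quotients of the normalizing constants converge to `c`, then `T c (μ)` divides `μ`. -/
lemma exists_conv_act_eq_of_tendsto (hT : InLPlus T) {m : ℕ → ProbabilityMeasure E}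
    {N M : ℕ → ℕ} {u v : ℕ → ℝ} {x y : ℕ → E} {c : ℝ} {μ : ProbabilityMeasure E}
    (hNM : ∀ n, N n ≤ M n) (hu : ∀ n, 0 < u n) (hv : ∀ n, 0 < v n)
    (hN : Tendsto (fun n => conv (act T (u n)⁻¹ (convProd m (N n))) (pointMass (x n))) atTop (𝓝 μ))
    (hM : Tendsto (fun n => conv (act T (v n)⁻¹ (convProd m (M n))) (pointMass (y n))) atTop (𝓝 μ))
    (hc : Tendsto (fun n => u n / v n) atTop (𝓝 c)) :
    ∃ ν, conv (act T c μ) ν = μ := by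
  choose ρ hρ using fun n => exists_convProd_eq_conv m (hNM n)
  have hA := tendsto_act hT hc hN
  -- The rescaled shift of the shorter product is compensated inside the cofactor, so no convergence
  -- of shifts is needed.
  let z : ℕ → E := fun n => scale T (u n / v n) (x n)
  have hz : ∀ n, act T (u n / v n) (conv (act T (u n)⁻¹ (convProd m (N n))) (pointMass (x n))) =
      conv (act T (v n)⁻¹ (convProd m (N n))) (pointMass (z n)) := fun n => by
    rw [act_conv, act_pointMass, ← act_mul (div_pos (hu n) (hv n)).le (inv_pos.2 (hu n)).le]
    congr 2
    have := (hu n).ne'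
    field_simp
  have hM' : Tendsto (fun n => conv
      (act T (u n / v n) (conv (act T (u n)⁻¹ (convProd m (N n))) (pointMass (x n))))
      (conv (act T (v n)⁻¹ (ρ n)) (pointMass (y n - z n)))) atTop (𝓝 μ) := by
    refine hM.congr fun n => ?_
    have h : pointMass (y n) = conv (pointMass (z n)) (pointMass (y n - z n)) := by
      rw [conv_pointMass, add_sub_cancel]
    rw [hz, hρ, act_conv, h]
    ac_rfl
  obtain ⟨-, β, -, -, hβ⟩ := exists_tendsto_cofactor hA hM'
  exact ⟨β, hβ⟩

lemma exists_conv_act_eq_of_mem_KTilde (hT : InLPlus T) {H : Set (ProbabilityMeasure E)} {b : ℝ}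
    {μ : ProbabilityMeasure E} (h : μ ∈ KTilde H b T) : ∃ ν, conv (act T b μ) ν = μ := by
  obtain ⟨m, a, k, x, -, hk, ha, hlim⟩ := h
  simp only [opMap_inv_eq_act] at hlim
  exact exists_conv_act_eq_of_tendsto hT (N := k) (M := fun n => k (n + 1))
    (fun n => (hk (Nat.lt_succ_self n)).le) (fun n => (a n).2) (fun n => (a (n + 1)).2) hlim
    (hlim.comp (tendsto_add_atTop_nat 1)) ha

/-- A measure which is asymptotically invariant under contractions is the point mass at `0`. -/
lemma eq_pointMass_zero_of_frequently_act_eq (hT : InLPlus T)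
    {p q e f : ℕ → ProbabilityMeasure E} {s : ℕ → ℝ} {c : ℝ} {π : ProbabilityMeasure E}
    (hp : Tendsto p atTop (𝓝 π)) (hq : Tendsto q atTop (𝓝 π))
    (he : Tendsto e atTop (𝓝 (pointMass 0))) (hf : Tendsto f atTop (𝓝 (pointMass 0)))
    (hc : c < 1) (h : ∃ᶠ n in atTop, s n ∈ Icc 0 c ∧
      conv (act T (s n) (p n)) (e n) = conv (q n) (act T (s n) (f n))) :
    π = pointMass 0 := by
  obtain ⟨φ, hφ, hφs⟩ := extraction_of_frequently_atTop h
  obtain ⟨r, hr, ψ, hψ, hψr⟩ := isCompact_Icc.tendsto_subseq fun n => (hφs n).1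
  have hlim := (hφ.comp hψ).tendsto_atTop
  have h1 := tendsto_conv (tendsto_act hT hψr (hp.comp hlim)) (he.comp hlim)
  have h2 := tendsto_conv (hq.comp hlim) (tendsto_act hT hψr (hf.comp hlim))
  have h3 := tendsto_nhds_unique h1 (h2.congr fun n => (hφs (ψ n)).2.symm)
  rw [act_pointMass_zero, conv_pointMass_zero, conv_pointMass_zero] at h3
  -- In the limit `π` is invariant under some `r ≤ c < 1`; iterating contracts it to `δ_0`.
  have h4 : ∀ k : ℕ, act T (r ^ k) π = π := by
    intro k
    induction k with
    | zero => rw [pow_zero, act_one]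
    | succ k ih => rw [pow_succ, act_mul (pow_nonneg hr.1 k) hr.1, h3, ih]
  have h5 := tendsto_act hT (tendsto_pow_atTop_nhds_zero_of_lt_one hr.1 (hr.2.trans_lt hc))
    (tendsto_const_nhds (x := π))
  rw [act_zero] at h5
  exact tendsto_nhds_unique (tendsto_const_nhds.congr fun k => (h4 k).symm) h5

/-- In an unbounded sequence with successive quotients tending to `1`, the quotients of terms
approximate any `c` in `(0, 1)`. -/
lemma exists_index_tendsto_div {b : ℕ → ℝ} (hb : ∀ n, 0 < b n) (hb' : Tendsto b atTop atTop)
    (hr : Tendsto (fun n => b n / b (n + 1)) atTop (𝓝 1)) {c : ℝ} (hc0 : 0 < c) (hc1 : c < 1) :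
    ∃ N : ℕ → ℕ, (∀ n, N n ≤ n) ∧ Tendsto N atTop atTop ∧
      Tendsto (fun n => b (N n) / b n) atTop (𝓝 c) := by
  classical
  -- For large `n`, maximality gives `b (N n) ≤ c * b n < b (N n + 1)`, so the ratio is squeezed
  -- between `c * (b (N n) / b (N n + 1))` and `c`.
  let N : ℕ → ℕ := fun n => Nat.findGreatest (fun k => b k ≤ c * b n) n
  have hev : ∀ K, ∀ᶠ n in atTop, b K ≤ c * b n := fun K =>
    (hb'.const_mul_atTop hc0).eventually_ge_atTop (b K)
  have hN : Tendsto N atTop atTop := by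
    refine tendsto_atTop.2 fun K => ?_
    filter_upwards [hev K, eventually_ge_atTop K] with n hn hK
    exact Nat.le_findGreatest hK hn
  refine ⟨N, fun n => Nat.findGreatest_le n, hN, ?_⟩
  have hlow : Tendsto (fun n => c * (b (N n) / b (N n + 1))) atTop (𝓝 c) := by
    simpa using (hr.comp hN).const_mul c
  have hspec : ∀ᶠ n in atTop, b (N n) ≤ c * b n := by
    filter_upwards [hev 0] with n hn
    exact Nat.findGreatest_spec (P := fun k => b k ≤ c * b n) (Nat.zero_le n) hn
  refine tendsto_of_tendsto_of_tendsto_of_le_of_le' hlow tendsto_const_nhds ?_ ?_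
  · filter_upwards [hspec] with n hn
    have hlt : N n < n := by
      refine lt_of_le_of_ne (Nat.findGreatest_le n) fun h => ?_
      rw [h] at hn
      nlinarith [hb n]
    have hgt : c * b n < b (N n + 1) := not_le.1
      (Nat.findGreatest_is_greatest (P := fun k => b k ≤ c * b n) (Nat.lt_succ_self _) hlt)
    rw [mul_div_assoc', div_le_div_iff₀ (hb _) (hb _)]
    nlinarith [hb (N n)]
  · filter_upwards [hspec] with n hn
    exact (div_le_iff₀ (hb n)).2 hn

lemma OperatorSelfdecomposable.exists_conv_act_eq (hT : InLPlus T) {μ : ProbabilityMeasure E}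
    (h : OperatorSelfdecomposable T μ) {c : ℝ} (hc0 : 0 < c) (hc1 : c < 1) :
    ∃ ν, conv (act T c μ) ν = μ := by
  -- Point masses are divided directly; otherwise a symmetrization equal to `δ_0` is the
  -- contradiction sought below.
  by_cases hdeg : symmetrize μ = pointMass 0
  · obtain ⟨x, rfl⟩ := exists_eq_pointMass_of_symmetrize_eq hdeg
    exact ⟨pointMass (x - scale T c x), by rw [act_pointMass, conv_pointMass, add_sub_cancel]⟩
  obtain ⟨m, x, b, hI, hlim⟩ := h
  simp only [opMap_inv_eq_act] at hI hlim
  have hb : ∀ n, (0 : ℝ) < b n := fun n => (b n).2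
  have hs : Tendsto (fun n => act T (b n : ℝ)⁻¹ (symmetrize (convProd m n))) atTop
      (𝓝 (symmetrize μ)) := by
    refine ((continuous_symmetrize.tendsto μ).comp hlim).congr fun n => ?_
    rw [Function.comp_apply, symmetrize_conv_pointMass, symmetrize_act]
  have hb' : Tendsto (fun n => (b n : ℝ)) atTop atTop := by
    by_contra hnot
    rw [tendsto_atTop] at hnot
    push Not at hnot
    obtain ⟨R, hR⟩ := hnot
    obtain ⟨φ, hφ, hφR⟩ := extraction_of_frequently_atTop hR
    obtain ⟨β, -, ψ, hψ, hψβ⟩ := (isCompact_Icc (a := (0 : ℝ)) (b := R)).tendsto_subseq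
      fun n => ⟨(hb (φ n)).le, (hφR n).le⟩
    -- Undoing the normalization along a bounded subsequence of `b` keeps the limit `δ_0`, so each
    -- fixed factor is trivial.
    have hm : ∀ i, m i = pointMass 0 := fun i => by
      have h1 := (hI.tendsto (i := fun _ => i) (eventually_gt_atTop i)).comp
        (hφ.comp hψ).tendsto_atTop
      have h2 := tendsto_act hT hψβ h1
      rw [act_pointMass_zero] at h2
      refine tendsto_nhds_unique (tendsto_const_nhds.congr fun n => ?_) h2
      simp only [Function.comp_apply]
      rw [← act_mul (hb _).le (inv_pos.2 (hb _)).le, mul_inv_cancel₀ (hb _).ne', act_one]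
    have hP : ∀ n, convProd m n = pointMass 0 := fun n => by
      induction n with
      | zero => rfl
      | succ n ih => rw [convProd, ih, hm, conv_pointMass_zero]
    refine hdeg (tendsto_nhds_unique hs (tendsto_const_nhds.congr fun n => ?_))
    rw [hP, symmetrize_pointMass, act_pointMass_zero]
  have hlast : Tendsto (fun n => act T (b (n + 1) : ℝ)⁻¹ (symmetrize (m n))) atTop
      (𝓝 (pointMass 0)) := by
    -- Row `n + 1` has `m n` as its last factor, at index `n`.
    have h1 := (hI.tendsto (i := fun n => n - 1)
      ((eventually_gt_atTop 0).mono fun n hn => by lia)).comp (tendsto_add_atTop_nat 1)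
    have h2 := (continuous_symmetrize.tendsto _).comp h1
    rw [symmetrize_pointMass] at h2
    refine h2.congr fun n => ?_
    simp only [Function.comp_apply, add_tsub_cancel_right]
    rw [symmetrize_act]
  have hstep : ∀ n, conv
      (act T ((b n : ℝ) / b (n + 1)) (act T (b n : ℝ)⁻¹ (symmetrize (convProd m n))))
      (act T (b (n + 1) : ℝ)⁻¹ (symmetrize (m n))) =
      act T (b (n + 1) : ℝ)⁻¹ (symmetrize (convProd m (n + 1))) := fun n => by
    rw [← act_mul (div_pos (hb _) (hb _)).le (inv_pos.2 (hb _)).le, convProd, symmetrize_conv,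
      act_conv, div_mul_eq_mul_div, mul_inv_cancel₀ (hb n).ne', one_div]
  have hs1 := hs.comp (tendsto_add_atTop_nat 1)
  have hr : Tendsto (fun n => (b n : ℝ) / b (n + 1)) atTop (𝓝 1) := by
    refine tendsto_order.2 ⟨fun a ha => ?_, fun a ha => ?_⟩
    · by_contra hnot
      rw [Filter.not_eventually] at hnot
      refine hdeg (eq_pointMass_zero_of_frequently_act_eq hT hs hs1 hlast
        (tendsto_const_nhds (x := pointMass 0)) ha (hnot.mono fun n hn => ⟨⟨?_, not_lt.1 hn⟩, ?_⟩))
      · exact (div_pos (hb _) (hb _)).le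
      · rw [act_pointMass_zero, conv_pointMass_zero]
        exact hstep n
    -- Ratios staying above `a > 1` are handled by inverting the recursion: the inverse ratio is a
    -- contraction carrying the next product to the current one.
    · by_contra hnot
      rw [Filter.not_eventually] at hnot
      refine hdeg (eq_pointMass_zero_of_frequently_act_eq hT hs1 hs
        (tendsto_const_nhds (x := pointMass 0)) hlast (inv_lt_one_of_one_lt₀ ha)
        (s := fun n => ((b n : ℝ) / b (n + 1))⁻¹) (hnot.mono fun n hn => ⟨⟨?_, ?_⟩, ?_⟩))
      · exact (inv_pos.2 (div_pos (hb _) (hb _))).le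
      · exact inv_anti₀ (by linarith) (not_lt.1 hn)
      · have hpos := div_pos (hb n) (hb (n + 1))
        rw [conv_pointMass_zero, Function.comp_apply, ← hstep, act_conv,
          ← act_mul (inv_pos.2 hpos).le hpos.le, inv_mul_cancel₀ hpos.ne', act_one]
  obtain ⟨N, hNn, hN, hNc⟩ := exists_index_tendsto_div hb hb' hr hc0 hc1
  exact exists_conv_act_eq_of_tendsto hT (N := N) (M := id) (u := fun n => b (N n))
    (v := fun n => b n) hNn (fun n => hb _) hb (hlim.comp hN) hlim hNc

end Decomposability

/-! ### From decomposability to limit theorems. -/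

section Construction

variable {E : Type*} [AddCommGroup E] [Module ℝ E] [TopologicalSpace E]
  [IsTopologicalAddGroup E] [ContinuousSMul ℝ E] [PolishSpace E] [MeasurableSpace E] [BorelSpace E]
  {T : PosReal →* (E ≃L[ℝ] E)}

lemma tendsto_natCast_div_add_one :
    Tendsto (fun n : ℕ => (n : ℝ) / (n + 1)) atTop (𝓝 1) :=
  tendsto_natCast_div_add_atTop 1

/-- The cofactors of `T c (μ)` in `μ` tend to the point mass at `0` as `c → 1`. -/
lemma tendsto_cofactor [SeparatingDual ℝ E] (hT : InLPlus T) {μ : ProbabilityMeasure E}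
    {c : ℕ → ℝ} (hc : Tendsto c atTop (𝓝 1)) {ν : ℕ → ProbabilityMeasure E}
    (hν : ∀ n, conv (act T (c n) μ) (ν n) = μ) : Tendsto ν atTop (𝓝 (pointMass 0)) := by
  -- Each subsequence has a further one converging to a cofactor of `μ` in itself, which must be
  -- `δ_0`.
  refine tendsto_of_subseq_tendsto fun ns hns => ?_
  have h1 : Tendsto (fun n => act T (c (ns n)) μ) atTop (𝓝 μ) := by
    simpa only [act_one, Function.comp_apply] using tendsto_act hT (hc.comp hns) (tendsto_const_nhds (x := μ))
  have h2 : Tendsto (fun n => conv (act T (c (ns n)) μ) (ν (ns n))) atTop (𝓝 μ) :=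
    tendsto_const_nhds.congr fun n => (hν (ns n)).symm
  obtain ⟨φ, β, -, hβ, hμβ⟩ := exists_tendsto_cofactor h1 h2
  rw [eq_pointMass_zero_of_conv_eq_self hμβ] at hβ
  exact ⟨φ, hβ⟩

/-- Late factors are near `δ_0` and stay so by equicontinuity, as the parameters are at most `1`;
the finitely many early ones are contracted to `δ_0`. -/
lemma infinitesimal_act (hT : InLPlus T) {ν : ℕ → ProbabilityMeasure E}
    (hν : Tendsto ν atTop (𝓝 (pointMass 0))) :
    Infinitesimal (fun n => n) fun n i => act T (((i : ℝ) + 1) / (n + 1)) (ν i) := by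
  intro U hU h0
  obtain ⟨V, hV, hVU⟩ := equicontinuous_scale hT 1 (hU.mem_nhds h0)
  obtain ⟨W, hWV, hW, hW0⟩ := mem_nhds_iff.1 hV
  refine ENNReal.tendsto_nhds_zero.2 fun ε hε => ?_
  have hlarge := ENNReal.tendsto_nhds_zero.1 (tendsto_pointMass_zero_iff.1 hν W hW hW0) ε hε
  obtain ⟨N, hN⟩ := eventually_atTop.1 hlarge
  have hsmall : ∀ᶠ n : ℕ in atTop, ∀ i < N,
      (act T (((i : ℝ) + 1) / (n + 1)) (ν i) : Measure E) Uᶜ ≤ ε := by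
    refine (finite_lt_nat N).eventually_all.2 fun i _ => ?_
    have h1 : Tendsto (fun n : ℕ => ((i : ℝ) + 1) / (n + 1)) atTop (𝓝 0) :=
      tendsto_const_nhds.div_atTop
        (tendsto_atTop_add_const_right _ _ tendsto_natCast_atTop_atTop)
    have h2 := tendsto_act hT h1 (tendsto_const_nhds (x := ν i))
    rw [act_zero] at h2
    exact ENNReal.tendsto_nhds_zero.1 (tendsto_pointMass_zero_iff.1 h2 U hU h0) ε hε
  filter_upwards [hsmall] with n hn
  refine iSup₂_le fun i hi => ?_
  rcases lt_or_ge i N with hiN | hiN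
  · exact hn i hiN
  refine le_trans ?_ (hN i hiN)
  change ((ν i : Measure E).map (scale T (((i : ℝ) + 1) / (n + 1)))) Uᶜ ≤ _
  rw [Measure.map_apply (continuous_scale_right _).measurable hU.measurableSet.compl]
  refine measure_mono fun x hx hxW => hx (hVU _ ?_ x (hWV hxW))
  have hin : (i : ℝ) ≤ n := by exact_mod_cast (Finset.mem_range.1 hi).le
  exact (div_le_one (by positivity)).2 (by linarith)

/-- If every `T c (μ)` with `0 < c < 1` divides `μ`, then `μ` is a limit of partial convolutions
of one sequence normalized by the integers. -/
lemma exists_infinitesimal_tendsto [SeparatingDual ℝ E] (hT : InLPlus T)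
    {μ : ProbabilityMeasure E}
    (h : ∀ c : ℝ, 0 < c → c < 1 → ∃ ν, conv (act T c μ) ν = μ) :
    ∃ m : ℕ → ProbabilityMeasure E,
      Infinitesimal (fun n => n) (fun n i => act T ((n : ℝ) + 1)⁻¹ (m i)) ∧
      Tendsto (fun n : ℕ => act T ((n : ℝ) + 1)⁻¹ (convProd m n)) atTop (𝓝 μ) := by
  have h' : ∀ n : ℕ, ∃ ν, conv (act T ((n : ℝ) / (n + 1)) μ) ν = μ := fun n => by
    -- At `n = 0` the parameter is `0` and `T 0 (μ) = δ_0`, so `μ` itself is the cofactor.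
    rcases n.eq_zero_or_pos with rfl | hn
    · exact ⟨μ, by simp [act_zero, pointMass_zero_conv]⟩
    · have : (0 : ℝ) < n := Nat.cast_pos.2 hn
      exact h _ (by positivity) ((div_lt_one (by positivity)).2 (by linarith))
  choose ν hν using h'
  have hprod : ∀ n : ℕ, convProd (fun i : ℕ => act T ((i : ℝ) + 1) (ν i)) n = act T n μ := by
    intro n
    induction n with
    | zero => rw [Nat.cast_zero, act_zero, convProd]
    | succ n ih =>
      have hn : (0 : ℝ) < n + 1 := by positivity
      have h1 : act T ((n : ℝ) + 1) (act T ((n : ℝ) / (n + 1)) μ) = act T n μ := by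
        rw [← act_mul hn.le (by positivity), mul_div_cancel₀ _ hn.ne']
      rw [convProd, ih, ← h1, ← act_conv, hν, Nat.cast_succ]
  refine ⟨fun i => act T ((i : ℝ) + 1) (ν i), ?_, ?_⟩
  · have h1 := infinitesimal_act hT (tendsto_cofactor hT tendsto_natCast_div_add_one hν)
    have h2 : ∀ n i : ℕ, act T (((i : ℝ) + 1) / (n + 1)) (ν i) =
        act T ((n : ℝ) + 1)⁻¹ (act T ((i : ℝ) + 1) (ν i)) := fun n i => by
      rw [← act_mul (by positivity) (by positivity), inv_mul_eq_div]
    simpa only [h2] using h1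
  · have h1 := tendsto_act hT tendsto_natCast_div_add_one (tendsto_const_nhds (x := μ))
    rw [act_one] at h1
    refine h1.congr fun n => ?_
    rw [hprod, ← act_mul (by positivity) (by positivity), inv_mul_eq_div]

lemma operatorSelfdecomposable_of_forall_exists_conv [SeparatingDual ℝ E] (hT : InLPlus T)
    {μ : ProbabilityMeasure E}
    (h : ∀ c : ℝ, 0 < c → c < 1 → ∃ ν, conv (act T c μ) ν = μ) :
    OperatorSelfdecomposable T μ := by
  obtain ⟨m, hm, hlim⟩ := exists_infinitesimal_tendsto hT h
  refine ⟨m, fun _ => 0, fun n => ⟨(n : ℝ) + 1, by positivity⟩, ?_, ?_⟩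
  · simpa only [opMap_inv_eq_act] using hm
  · simpa only [opMap_inv_eq_act, conv_pointMass_zero] using hlim

lemma Infinitesimal.comp {E : Type*} [AddCommGroup E] [TopologicalSpace E]
    [MeasurableSpace E] {k : ℕ → ℕ} {lam : ℕ → ℕ → ProbabilityMeasure E} (h : Infinitesimal k lam)
    {φ : ℕ → ℕ} (hφ : Tendsto φ atTop atTop) :
    Infinitesimal (fun n => k (φ n)) fun n => lam (φ n) :=
  fun U hU h0 => (h U hU h0).comp hφ

/-- There is a strictly increasing sequence of integers growing geometrically with ratio `b⁻¹`. -/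
lemma exists_strictMono_tendsto_div {b : ℝ} (hb0 : 0 < b) (hb1 : b < 1) :
    ∃ k : ℕ → ℕ, StrictMono k ∧
      Tendsto (fun n => ((k n : ℝ) + 1) / ((k (n + 1) : ℝ) + 1)) atTop (𝓝 b) := by
  have hb : 1 < b⁻¹ := (one_lt_inv₀ hb0).2 hb1
  -- The summand `n` forces strict monotonicity and is negligible against `b⁻¹ ^ n`.
  let k : ℕ → ℕ := fun n => ⌊b⁻¹ ^ n⌋₊ + n
  have hk : StrictMono k := strictMono_nat_of_lt_succ fun n =>
    add_lt_add_of_le_of_lt (Nat.floor_mono (pow_le_pow_right₀ hb.le n.le_succ)) n.lt_succ_self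
  have h1 : Tendsto (fun n => ((k n : ℝ) + 1) / b⁻¹ ^ n) atTop (𝓝 1) := by
    have hpow := tendsto_pow_atTop_atTop_of_one_lt hb
    have ha := (tendsto_nat_floor_div_atTop (R := ℝ)).comp hpow
    have hn := tendsto_pow_const_div_const_pow_of_one_lt 1 hb
    have hc := (tendsto_const_nhds (x := (1 : ℝ))).div_atTop hpow
    have := (ha.add hn).add hc
    simp only [add_zero] at this
    refine this.congr fun n => ?_
    simp only [k, Function.comp_apply, pow_one, Nat.cast_add]
    ring
  refine ⟨k, hk, ?_⟩
  have h2 := (h1.div (h1.comp (tendsto_add_atTop_nat 1)) one_ne_zero).const_mul b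
  rw [div_one, mul_one] at h2
  refine h2.congr fun n => ?_
  have hp : (0 : ℝ) < (k (n + 1) : ℝ) + 1 := by positivity
  simp only [Pi.div_apply, Function.comp_apply, pow_succ]
  field_simp

lemma mem_L0_of_forall_exists_conv [SeparatingDual ℝ E] (hT : InLPlus T)
    {μ : ProbabilityMeasure E}
    (h : ∀ c : ℝ, 0 < c → c < 1 → ∃ ν, conv (act T c μ) ν = μ) {b : ℝ} (hb0 : 0 < b)
    (hb1 : b < 1) : μ ∈ L0 b T := by
  obtain ⟨m, hm, hlim⟩ := exists_infinitesimal_tendsto hT h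
  obtain ⟨k, hk, hkb⟩ := exists_strictMono_tendsto_div hb0 hb1
  refine ⟨m, fun n => ⟨(k n : ℝ) + 1, by positivity⟩, k, fun _ => 0, fun _ => mem_univ _, hk, hkb,
    ?_, ?_⟩
  · simpa only [opMap_inv_eq_act, conv_pointMass_zero, Function.comp_def] using
      hlim.comp hk.tendsto_atTop
  · simpa only [opMap_inv_eq_act] using hm.comp hk.tendsto_atTop

lemma mem_Icc_diff_iff {b : ℝ} : b ∈ Icc (0 : ℝ) 1 \ {0, 1} ↔ 0 < b ∧ b < 1 := by
  constructor
  · rintro ⟨⟨h0, h1⟩, hb⟩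
    simp only [mem_insert_iff, mem_singleton_iff, not_or] at hb
    exact ⟨lt_of_le_of_ne h0 (Ne.symm hb.1), lt_of_le_of_ne h1 hb.2⟩
  · rintro ⟨h0, h1⟩
    exact ⟨⟨h0.le, h1.le⟩, by simp [h0.ne', h1.ne]⟩

end Construction

end OpSelfDec

theorem mainTheorem2 {E : Type*} [AddCommGroup E] [Module ℝ E] [TopologicalSpace E]
    [IsTopologicalAddGroup E] [ContinuousSMul ℝ E] [PolishSpace E]
    [MeasurableSpace E] [BorelSpace E] [SeparatingDual ℝ E]
    (hE : OpSelfDec.StronglyRootCompact E)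
    (T : OpSelfDec.PosReal →* (E ≃L[ℝ] E)) (hT : OpSelfDec.InLPlus T)
    (μ : ProbabilityMeasure E) :
    List.TFAE [
      OpSelfDec.OperatorSelfdecomposable T μ,
      μ ∈ OpSelfDec.L0Unit T,
      μ ∈ OpSelfDec.L0TildeUnit T,
      ∀ b : ℝ, 0 < b → b < 1 → μ ∈ OpSelfDec.L0 b T] := by
  tfae_have 1 → 4 := fun h b hb0 hb1 =>
    OpSelfDec.mem_L0_of_forall_exists_conv hT
      (fun c hc0 hc1 => h.exists_conv_act_eq hT hc0 hc1) hb0 hb1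
  tfae_have 4 → 2 := fun h => mem_iInter₂.2 fun b hb =>
    h b (OpSelfDec.mem_Icc_diff_iff.1 hb).1 (OpSelfDec.mem_Icc_diff_iff.1 hb).2
  tfae_have 2 → 3 := fun h => mem_iInter₂.2 fun b hb => by
    obtain ⟨m, a, k, x, hm, hk, ha, hlim, -⟩ := mem_iInter₂.1 h b hb
    exact ⟨m, a, k, x, hm, hk, ha, hlim⟩
  tfae_have 3 → 1 := fun h =>
    OpSelfDec.operatorSelfdecomposable_of_forall_exists_conv hT fun c hc0 hc1 =>
      OpSelfDec.exists_conv_act_eq_of_mem_KTilde hT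
        (mem_iInter₂.1 h c (OpSelfDec.mem_Icc_diff_iff.2 ⟨hc0, hc1⟩))
  tfae_finish
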